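/- Let $p$ be a prime, $n\ge 0$, let $G$ be a finite group of order $p^n$ and let $k$ be a field of characteristic $p$. Let $kG=\bigoplus_{g\in G}kX_g$ be the regular right $kG$-module, with $X_g\cdot h=X_{gh}$ for $g,h\in G$, and let $$D_k:=\mathrm{Sym}_k(kG)/(\alpha),\qquad \alpha=-1+\sum_{g\in G}X_g,$$ be the dehomogenized symmetric algebra with the induced right action of $G$ by $k$-algebra automorphisms. For a $G$-stable $k$-subalgebra $U\le D_k$ write $U^G$ for its ring of invariants and $\mathrm{tr}(u)=\sum_{g\in G}u\cdot g$; $U$ is called trace-surjective if $\mathrm{tr}(U)=U^G$. Then there exist a $k$-subalgebra $U\le D_k$, an ideal $I\unlhd D_k$ and elements $Y_0,\dots,Y_{n-1}\in D_k$ such that: 1. $U$ is $G$-stable and trace-surjective, $I$ is $G$-stable, and $D_k=U\oplus I$ as $k$-vector spaces (so $U$ is a retract of $D_k$); 2. $Y_0,\dots,Y_{n-1}$ are algebraically independent over $k$ and $U=k[Y_0,\dots,Y_{n-1}]$, so $U$ is a polynomial ring in $n$ variables; moreover $G$ acts triangularly: for every $g\in G$ and every $0\le i\le n-1$ there is a polynomial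 $f_{i,g}$ over $k$ in $n-1-i$ variables with $$Y_i\cdot g=Y_i+f_{i,g}(Y_{i+1},\dots,Y_{n-1});$$ 3. the ring of invariants $U^G$ is isomorphic, as a $k$-algebra, to a polynomial ring over $k$ in $n$ variables. -/

import Mathlib

/-- For `h : G`, the endomorphism of the regular right module `kG` given by right multiplication
by `h`; it sends the basis vector `X_g = single g 1` to `X_{gh}`. -/
noncomputable def regularRightMul (k G : Type*) [Field k] [Group G] (h : G) :
    MonoidAlgebra k G →ₗ[k] MonoidAlgebra k G :=
  LinearMap.mulRight k (MonoidAlgebra.single h 1)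

/-- The induced `k`-algebra endomorphism of `Sym_k(kG)`, determined by `X_g ↦ X_{gh}`. -/
noncomputable def symRightMul (k G : Type*) [Field k] [Group G] (h : G) :
    SymmetricAlgebra k (MonoidAlgebra k G) →ₐ[k] SymmetricAlgebra k (MonoidAlgebra k G) :=
  SymmetricAlgebra.lift (SymmetricAlgebra.ι k (MonoidAlgebra k G) ∘ₗ regularRightMul k G h)

/-- The generator `X_g` of `Sym_k(kG)`. -/
noncomputable def symX (k : Type*) {G : Type*} [Field k] [Group G] (g : G) :
    SymmetricAlgebra k (MonoidAlgebra k G) :=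
  SymmetricAlgebra.ι k (MonoidAlgebra k G) (MonoidAlgebra.single g 1)

theorem symRightMul_symX (k : Type*) {G : Type*} [Field k] [Group G] (g h : G) :
    symRightMul k G h (symX k g) = symX k (g * h) := by
  simp [symRightMul, symX, regularRightMul, MonoidAlgebra.single_mul_single]

theorem symRightMul_one (k G : Type*) [Field k] [Group G] :
    symRightMul k G 1 = AlgHom.id k _ := by
  apply SymmetricAlgebra.algHom_ext
  ext a
  simp [symRightMul, regularRightMul, ← MonoidAlgebra.one_def]

theorem symRightMul_mul (k : Type*) {G : Type*} [Field k] [Group G] (g h : G) :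
    symRightMul k G (g * h) = (symRightMul k G h).comp (symRightMul k G g) := by
  apply SymmetricAlgebra.algHom_ext
  ext a
  simp [symRightMul, regularRightMul, MonoidAlgebra.single_mul_single, mul_assoc]

/-- The element `α = -1 + ∑_g X_g` of `Sym_k(kG)`. -/
noncomputable def dehomRelation (k G : Type*) [Field k] [Group G] [Fintype G] :
    SymmetricAlgebra k (MonoidAlgebra k G) :=
  -1 + ∑ g : G, symX k g

theorem symRightMul_dehomRelation (k : Type*) {G : Type*} [Field k] [Group G] [Fintype G]
    (h : G) : symRightMul k G h (dehomRelation k G) = dehomRelation k G := by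
  simp only [dehomRelation, map_add, map_neg, map_one, map_sum, symRightMul_symX]
  congr 1
  exact Fintype.sum_equiv (Equiv.mulRight h) _ _ fun _ => rfl

/-- The dehomogenized symmetric algebra `D_k(G) = Sym_k(kG) / (-1 + ∑_g X_g)`. -/
def DehomSym (k G : Type*) [Field k] [Group G] [Fintype G] : Type _ :=
  SymmetricAlgebra k (MonoidAlgebra k G) ⧸ Ideal.span {dehomRelation k G}

noncomputable instance (k G : Type*) [Field k] [Group G] [Fintype G] :
    CommRing (DehomSym k G) :=
  inferInstanceAs
    (CommRing (SymmetricAlgebra k (MonoidAlgebra k G) ⧸ Ideal.span {dehomRelation k G}))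

noncomputable instance (k G : Type*) [Field k] [Group G] [Fintype G] :
    Algebra k (DehomSym k G) :=
  inferInstanceAs
    (Algebra k (SymmetricAlgebra k (MonoidAlgebra k G) ⧸ Ideal.span {dehomRelation k G}))

/-- The quotient map `Sym_k(kG) → D_k(G)`. -/
noncomputable def DehomSym.mk (k G : Type*) [Field k] [Group G] [Fintype G] :
    SymmetricAlgebra k (MonoidAlgebra k G) →ₐ[k] DehomSym k G :=
  Ideal.Quotient.mkₐ k (Ideal.span {dehomRelation k G})

theorem DehomSym.mk_surjective (k G : Type*) [Field k] [Group G] [Fintype G] :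
    Function.Surjective (DehomSym.mk k G) :=
  Ideal.Quotient.mk_surjective

/-- The endomorphism of `D_k(G)` induced by `X_g ↦ X_{gh}`. -/
noncomputable def DehomSym.act (k : Type*) {G : Type*} [Field k] [Group G] [Fintype G] (h : G) :
    DehomSym k G →ₐ[k] DehomSym k G :=
  Ideal.quotientMapₐ (Ideal.span {dehomRelation k G}) (symRightMul k G h) (by
    rw [Ideal.span_singleton_le_iff_mem, Ideal.mem_comap]
    exact (symRightMul_dehomRelation k h).symm ▸ Ideal.mem_span_singleton_self _)

theorem DehomSym.act_mk (k : Type*) {G : Type*} [Field k] [Group G] [Fintype G] (h : G)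
    (s : SymmetricAlgebra k (MonoidAlgebra k G)) :
    DehomSym.act k h (DehomSym.mk k G s) = DehomSym.mk k G (symRightMul k G h s) :=
  rfl

/-- The right action of `G` on `D_k(G)` by `k`-algebra automorphisms, `X_g · h = X_{gh}`. A right
action of `G` is a left action of the opposite group `Gᵐᵒᵖ`, and `a · h` is `op h • a`. -/
noncomputable instance (k G : Type*) [Field k] [Group G] [Fintype G] :
    MulSemiringAction Gᵐᵒᵖ (DehomSym k G) where
  smul h a := DehomSym.act k h.unop a
  one_smul a := by
    obtain ⟨s, rfl⟩ := DehomSym.mk_surjective k G a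
    change DehomSym.act k (1 : G) _ = _
    rw [DehomSym.act_mk, symRightMul_one, AlgHom.id_apply]
  mul_smul g h a := by
    obtain ⟨s, rfl⟩ := DehomSym.mk_surjective k G a
    change DehomSym.act k (h.unop * g.unop) _ =
      DehomSym.act k g.unop (DehomSym.act k h.unop _)
    simp only [DehomSym.act_mk, symRightMul_mul, AlgHom.comp_apply]
  smul_zero g := map_zero (DehomSym.act k g.unop)
  smul_add g := map_add (DehomSym.act k g.unop)
  smul_one g := map_one (DehomSym.act k g.unop)
  smul_mul g := map_mul (DehomSym.act k g.unop)

theorem DehomSym.op_smul_eq (k : Type*) {G : Type*} [Field k] [Group G] [Fintype G] (h : G)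
    (a : DehomSym k G) : MulOpposite.op h • a = DehomSym.act k h a :=
  rfl

instance (k G : Type*) [Field k] [Group G] [Fintype G] :
    SMulCommClass Gᵐᵒᵖ k (DehomSym k G) where
  smul_comm g c a := map_smul (DehomSym.act k g.unop) c a

/-- A set is stable under the right action of `G`. -/
def IsGStable (G : Type*) {A : Type*} [Group G] [CommRing A] [MulSemiringAction Gᵐᵒᵖ A]
    (S : Set A) : Prop :=
  ∀ g : G, ∀ a ∈ S, MulOpposite.op g • a ∈ S

/-- The transfer (trace) map `tr(a) = ∑_g a · g`. -/
def transfer (G : Type*) {A : Type*} [Group G] [Fintype G] [CommRing A]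
    [MulSemiringAction Gᵐᵒᵖ A] (a : A) : A :=
  ∑ g : G, MulOpposite.op g • a

/-- The ring of invariants `U^G` of a subalgebra `U` of a `G`-algebra. -/
def invariantSubalgebra (G : Type*) {k A : Type*} [Group G] [Field k] [CommRing A] [Algebra k A]
    [MulSemiringAction Gᵐᵒᵖ A] [SMulCommClass Gᵐᵒᵖ k A] (U : Subalgebra k A) : Subalgebra k A :=
  U ⊓ FixedPoints.subalgebra k A Gᵐᵒᵖ

/-- `U` is a trace-surjective `G`-subalgebra: it is `G`-stable and `tr(U) = U^G`. -/
def IsTraceSurjectiveSubalgebra (G : Type*) {k A : Type*} [Group G] [Fintype G] [Field k]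
    [CommRing A] [Algebra k A] [MulSemiringAction Gᵐᵒᵖ A] [SMulCommClass Gᵐᵒᵖ k A]
    (U : Subalgebra k A) : Prop :=
  IsGStable G (U : Set A) ∧
    transfer G '' (U : Set A) = (invariantSubalgebra G U : Set A)

/-!
For a finite `p`-group `G`, the algebra `D_k` is the universal `G`-algebra with an element of trace
one: `X_1` has trace `∑ X_g = 1`, and a `G`-algebra `B` with an element `t` of trace one receives
the equivariant map `X_g ↦ t · g` (`DehomSym.exists_algHom`). So it suffices to construct a
triangular polynomial `G`-algebra `B` with polynomial invariants which is generated by the orbit of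
an element of trace one and is projective for equivariant surjections. The map `D_k → B` is then
surjective and splits; `U` is the image of the splitting and `I` is the kernel of `D_k → B`.

Such an algebra (`TriangularModel`) is built one variable at a time along central subgroups `Z` of
order `p`. Let `B` be a model for `G ⧸ Z`, with `t` its element of trace one. Since 1-cocycles with
values in an algebra with an element of trace one are coboundaries
(`exists_apply_eq_add_of_cocycle`), and by the same averaging, the isomorphism of `Z` with the prime
field extends to a cocycle `f : G → B` (`exists_cocycle_extending`). Let `G` act on `B[X]` by
`g • X = X + f g`, so that `Z` acts by the translations by the prime field.

* The identities `∑ (X + a) ^ (p - 1) = -1` and `∑ a (X + a) ^ (p - 1) = X + const` over `a` in the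
  prime field show that `-X ^ (p - 1) * t` has trace one and that its orbit generates `B[X]`.
* The cocycle `f ^ p - f` factors through `G ⧸ Z`, hence is the coboundary of some `v : B`, and
  `X ^ p - X - v` is invariant. Division by this monic polynomial shows that it generates the
  invariants of `B[X]` over those of `B`: an invariant remainder has degree less than `p` and is
  unchanged by the `p` translations, hence is constant
  (`nonempty_invariants_translationAction_equiv`).
* A lift of `B` along an equivariant surjection `D → A` extends to `X`, since the obstruction is a
  cocycle in `D`, and since invariants of `A`, being traces, lift to invariants of `D`
  (`exists_equivariant_lift_of_translationAction`).

Right actions of `G` are treated as left actions of `Gᵐᵒᵖ`, and actions of an abstract group on `A`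
by algebra endomorphisms as homomorphisms to the monoid `A →ₐ[k] A`.
-/

open Polynomial

/-! ### Actions on algebras with an element of trace one -/

/-- The subalgebra of invariants of an action `ρ` of `G` on `A` by `k`-algebra endomorphisms. -/
def actionInvariants {k G A : Type*} [Field k] [Group G] [CommRing A] [Algebra k A]
    (ρ : G →* (A →ₐ[k] A)) : Subalgebra k A where
  carrier := {a | ∀ g, ρ g a = a}
  mul_mem' ha hb g := by rw [map_mul, ha g, hb g]
  add_mem' ha hb g := by rw [map_add, ha g, hb g]
  algebraMap_mem' r g := (ρ g).commutes r

theorem mem_actionInvariants {k G A : Type*} [Field k] [Group G] [CommRing A] [Algebra k A]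
    {ρ : G →* (A →ₐ[k] A)} {a : A} : a ∈ actionInvariants ρ ↔ ∀ g, ρ g a = a :=
  Iff.rfl

theorem action_mul_apply {k G A : Type*} [Field k] [Group G] [CommRing A] [Algebra k A]
    (ρ : G →* (A →ₐ[k] A)) (g h : G) (a : A) : ρ (g * h) a = ρ g (ρ h a) := by
  rw [map_mul, AlgHom.mul_apply]

/-- In the presence of an element of trace one, every 1-cocycle is a coboundary. -/
theorem exists_apply_eq_add_of_cocycle {k G A : Type*} [Field k] [Group G] [Fintype G]
    [CommRing A] [Algebra k A] (ρ : G →* (A →ₐ[k] A)) {t : A} (ht : ∑ g, ρ g t = 1)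
    (f : G → A) (hf : ∀ g h, f (g * h) = f g + ρ g (f h)) :
    ∃ a, ∀ g, ρ g a = a + f g := by
  refine ⟨-∑ x, f x * ρ x t, fun g => ?_⟩
  have h1 : ∀ x, ρ g (f x * ρ x t) = f (g * x) * ρ (g * x) t - f g * ρ (g * x) t := fun x => by
    rw [map_mul, hf, action_mul_apply]; ring
  have h2 (F : G → A) : ∑ x, F (g * x) = ∑ x, F x :=
    Fintype.sum_equiv (Equiv.mulLeft g) _ _ fun _ => rfl
  rw [map_neg, map_sum, Finset.sum_congr rfl fun x _ => h1 x, Finset.sum_sub_distrib,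
    h2 (fun x => f x * ρ x t), ← Finset.mul_sum, h2 (fun x => ρ x t), ht]
  ring

/-- In the presence of an element of trace one, every invariant is a trace. -/
theorem sum_apply_mul_eq_of_mem_actionInvariants {k G A : Type*} [Field k] [Group G] [Fintype G]
    [CommRing A] [Algebra k A] (ρ : G →* (A →ₐ[k] A)) {t : A} (ht : ∑ g, ρ g t = 1)
    {a : A} (ha : a ∈ actionInvariants ρ) : ∑ g, ρ g (a * t) = a := by
  simp_rw [map_mul, mem_actionInvariants.1 ha]
  rw [← Finset.mul_sum, ht, mul_one]

theorem sum_apply_mem_actionInvariants {k G A : Type*} [Field k] [Group G] [Fintype G]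
    [CommRing A] [Algebra k A] (ρ : G →* (A →ₐ[k] A)) (a : A) :
    ∑ g, ρ g a ∈ actionInvariants ρ := by
  intro g
  simp_rw [map_sum, ← action_mul_apply]
  exact Fintype.sum_equiv (Equiv.mulLeft g) _ _ fun _ => rfl

/-- Invariants lift along equivariant surjections from an algebra with an element of trace one. -/
theorem exists_mem_actionInvariants_of_surjective {k G D A : Type*} [Field k] [Group G]
    [Fintype G] [CommRing D] [Algebra k D] [CommRing A] [Algebra k A]
    (ρD : G →* (D →ₐ[k] D)) (ρA : G →* (A →ₐ[k] A)) {t : D} (ht : ∑ g, ρD g t = 1)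
    (π : D →ₐ[k] A) (hπ : Function.Surjective π) (hπρ : ∀ g d, π (ρD g d) = ρA g (π d))
    {a : A} (ha : a ∈ actionInvariants ρA) : ∃ d ∈ actionInvariants ρD, π d = a := by
  obtain ⟨d, rfl⟩ := hπ a
  refine ⟨∑ g, ρD g (d * t), sum_apply_mem_actionInvariants ρD _, ?_⟩
  simp_rw [map_sum, hπρ, map_mul]
  have h := sum_apply_mul_eq_of_mem_actionInvariants ρA (t := π t)
    (by simp_rw [← hπρ, ← map_sum, ht, map_one]) ha
  simpa only [map_mul] using h

/-! ### The translation action on a polynomial ring -/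

/-- Given an action `ρ` of `G` on `A` and a 1-cocycle `f : G → A`, the action on `A[X]` extending
`ρ` with `g • X = X + f g`. -/
noncomputable def translationAction {k G A : Type*} [Field k] [Group G] [CommRing A] [Algebra k A]
    (ρ : G →* (A →ₐ[k] A)) (f : G → A) (hf : ∀ g h, f (g * h) = f g + ρ g (f h)) :
    G →* (A[X] →ₐ[k] A[X]) where
  toFun g := aevalTower (CAlgHom.comp (ρ g)) (X + C (f g))
  map_one' := by
    have h1 : f 1 = 0 := by simpa using hf 1 1
    apply Polynomial.algHom_ext'
    · ext a; simp
    · simp [h1]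
  map_mul' g h := by
    apply Polynomial.algHom_ext'
    · ext a; simp
    · simp [hf, add_assoc]

section translationAction

variable {k G A : Type*} [Field k] [Group G] [CommRing A] [Algebra k A]
  (ρ : G →* (A →ₐ[k] A)) (f : G → A) (hf : ∀ g h, f (g * h) = f g + ρ g (f h))

theorem translationAction_C (g : G) (a : A) :
    translationAction ρ f hf g (C a) = C (ρ g a) := by
  simp [translationAction]

theorem translationAction_X (g : G) :
    translationAction ρ f hf g X = X + C (f g) := by
  simp [translationAction]

theorem translationAction_apply (g : G) (P : A[X]) :
    translationAction ρ f hf g P = (P.map (ρ g : A →+* A)).comp (X + C (f g)) := by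
  rw [comp, eval₂_map]
  rfl

theorem natDegree_translationAction_le (g : G) (P : A[X]) :
    (translationAction ρ f hf g P).natDegree ≤ P.natDegree := by
  rw [translationAction_apply]
  refine natDegree_comp_le.trans ?_
  calc _ ≤ P.natDegree * 1 := Nat.mul_le_mul natDegree_map_le (by compute_degree)
    _ = _ := mul_one _

end translationAction

/-! ### Power sums over the prime field -/

/-- The sum of `y ^ (p - 1)` over the translates of `y` by the prime field is `-1`. -/
theorem sum_add_cast_pow_sub_one {p : ℕ} [Fact p.Prime] {R : Type*} [CommRing R]
    (c : ZMod p →+* R) (y : R) : ∑ a : ZMod p, (y + c a) ^ (p - 1) = -1 := by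
  have hp := (Fact.out : p.Prime)
  simp_rw [add_pow]
  rw [Finset.sum_comm, Finset.sum_eq_single 0]
  · have h1 : ∑ a : ZMod p, a ^ (p - 1) = -1 := by
      simp_rw [ZMod.pow_card_sub_one]
      rw [Finset.sum_ite, Finset.sum_const_zero, add_zero, Finset.sum_const, nsmul_one,
        Finset.filter_ne', Finset.card_erase_of_mem (Finset.mem_univ _), Finset.card_univ,
        ZMod.card, Nat.cast_sub hp.one_le]
      simp
    have h2 := congrArg c h1
    simpa using h2
  · intro j hj hj0
    have : ∑ a : ZMod p, a ^ (p - 1 - j) = 0 := by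
      apply FiniteField.sum_pow_lt_card_sub_one
      rw [ZMod.card]
      have := hp.two_le
      omega
    have h2 := congrArg c this
    rw [map_sum, map_zero] at h2
    simp_rw [map_pow] at h2
    rw [← Finset.sum_mul, ← Finset.mul_sum, h2, mul_zero, zero_mul]
  · simp

theorem sum_cast_mul_add_cast_pow_sub_one {p : ℕ} [Fact p.Prime] {R : Type*} [CommRing R]
    [CharP R p] (c : ZMod p →+* R) (y : R) :
    ∑ a : ZMod p, c a * (y + c a) ^ (p - 1) = y + c (∑ a, a) := by
  have hp := (Fact.out : p.Prime)
  -- Multiply by `y + c a` and use that the `p`-th power is additive.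
  have h1 (a : ZMod p) : c a * (y + c a) ^ (p - 1) = y ^ p + c a - y * (y + c a) ^ (p - 1) := by
    have h2 : (y + c a) ^ (p - 1) * (y + c a) = y ^ p + c a := by
      rw [← pow_succ, Nat.sub_add_cancel hp.one_le, add_pow_char, ← map_pow, ZMod.pow_card]
    linear_combination h2
  simp_rw [h1]
  rw [Finset.sum_sub_distrib, Finset.sum_add_distrib, ← Finset.mul_sum,
    sum_add_cast_pow_sub_one, map_sum]
  simp
  ring

/-! ### Cocycles of a central extension -/

theorem sum_eq_sum_quotient_sum_subgroup {G A : Type*} [Group G] [Fintype G] [AddCommMonoid A]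
    (Z : Subgroup G) [Fintype (G ⧸ Z)] [Fintype Z] (F : G → A) :
    ∑ g, F g = ∑ x : G ⧸ Z, ∑ z : Z, F (x.out * z) := by
  rw [← Fintype.sum_prod_type']
  symm
  refine Fintype.sum_bijective (fun y : (G ⧸ Z) × Z => y.1.out * (y.2 : G)) ⟨?_, ?_⟩ _ _
    fun _ => rfl
  · rintro ⟨x, z⟩ ⟨y, w⟩ h
    have hxy : x = y := by
      have := congrArg (QuotientGroup.mk : G → G ⧸ Z) h
      simpa [QuotientGroup.mk_mul_of_mem] using this
    subst hxy
    simpa using h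
  · intro g
    exact ⟨(g, ⟨_, QuotientGroup.eq.1 (QuotientGroup.out_eq' (g : G ⧸ Z))⟩), by simp⟩

/-- Every character `χ : Z → (k, +)` of a central subgroup `Z` extends to a 1-cocycle of `G` with
values in a `G ⧸ Z`-algebra that has an element of trace one. -/
theorem exists_cocycle_extending {k G A : Type*} [Field k] [Group G] [CommRing A] [Algebra k A]
    (Z : Subgroup G) [Z.Normal] (hZ : Z ≤ Subgroup.center G) [Fintype (G ⧸ Z)]
    (ρ : G ⧸ Z →* (A →ₐ[k] A)) {t : A} (ht : ∑ x, ρ x t = 1) (χ : Z →* Multiplicative k) :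
    ∃ f : G → A, (∀ g h : G, f (g * h) = f g + ρ g (f h)) ∧
      ∀ z : Z, f z = algebraMap k A (χ z).toAdd := by
  -- `u g x` is the factor in `Z` by which `g * s x` and `s (g * x)` differ, for the section `s`
  -- given by `Quotient.out`.
  have hu (g : G) (x : G ⧸ Z) : ((g : G ⧸ Z) * x).out⁻¹ * (g * x.out) ∈ Z := by
    rw [← QuotientGroup.eq]
    simp
  let u (g : G) (x : G ⧸ Z) : Z := ⟨_, hu g x⟩
  have u_mul (g h : G) (x : G ⧸ Z) : u (g * h) x = u g (h * x) * u h x := by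
    apply Subtype.ext
    simp only [u, Subgroup.coe_mul, QuotientGroup.mk_mul, mul_assoc]
    group
  have u_coe (z : Z) (x : G ⧸ Z) : u z x = z := by
    apply Subtype.ext
    have h1 : ((z : G) : G ⧸ Z) = 1 := (QuotientGroup.eq_one_iff _).2 z.2
    have h2 := Subgroup.mem_center_iff.1 (hZ z.2) x.out
    simp only [u, h1, one_mul]
    rw [← h2]
    simp
  refine ⟨fun g => ∑ x, algebraMap k A (χ (u g x)).toAdd * ρ (g * x) t, fun g h => ?_,
    fun z => ?_⟩
  · simp only [u_mul, map_mul χ, toAdd_mul, map_add, add_mul, Finset.sum_add_distrib, map_sum,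
      map_mul, AlgHom.commutes, QuotientGroup.mk_mul, ← AlgHom.mul_apply]
    congr 1
    exact Fintype.sum_equiv (Equiv.mulLeft (h : G ⧸ Z)) _ _ fun x => by simp [mul_assoc]
  · have h1 : ((z : G) : G ⧸ Z) = 1 := (QuotientGroup.eq_one_iff _).2 z.2
    simp only [u_coe, h1, one_mul]
    rw [← Finset.mul_sum, ht, mul_one]

/-! ### Extending a model by one variable -/

section CentralExtension

variable {p : ℕ} [Fact p.Prime] {k G A : Type*} [Field k] [CharP k p] [Group G]
  [CommRing A] [Algebra k A] {Z : Subgroup G} [Z.Normal]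
  (e : Z ≃* Multiplicative (ZMod p)) (ρ : G ⧸ Z →* (A →ₐ[k] A)) (t : A) (f : G → A)
  (hf : ∀ g h : G, f (g * h) = f g + ρ.comp (QuotientGroup.mk' Z) g (f h))

theorem translationAction_coe_subgroup_X
    (hfZ : ∀ z : Z, f z = algebraMap k A (ZMod.castHom dvd_rfl k (e z).toAdd))
    (z : Z) :
    translationAction _ f hf (z : G) X =
      X + ((algebraMap k A[X]).comp (ZMod.castHom dvd_rfl k)) (e z).toAdd := by
  rw [translationAction_X, hfZ]
  rfl

theorem translationAction_coe_subgroup_C (z : Z) (a : A) :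
    translationAction (ρ.comp (QuotientGroup.mk' Z)) f hf (z : G) (C a) = C a := by
  have h1 : ((z : G) : G ⧸ Z) = 1 := (QuotientGroup.eq_one_iff _).2 z.2
  rw [translationAction_C]
  simp [h1]

theorem sum_translationAction_mul_coe
    (hfZ : ∀ z : Z, f z = algebraMap k A (ZMod.castHom dvd_rfl k (e z).toAdd))
    [Fintype Z] (g : G) :
    ∑ z : Z, translationAction _ f hf (g * z) (-(X ^ (p - 1) * C t)) = C (ρ g t) := by
  have h1 : ∑ z : Z, translationAction _ f hf (z : G) (-(X ^ (p - 1) * C t)) = C t := by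
    simp only [map_neg, map_mul, map_pow, translationAction_coe_subgroup_C ρ f hf,
      translationAction_coe_subgroup_X e ρ f hf hfZ]
    rw [Finset.sum_neg_distrib, ← Finset.sum_mul]
    have h2 := ((e.toEquiv.trans Multiplicative.toAdd).sum_comp fun a =>
      (X + ((algebraMap k A[X]).comp (ZMod.castHom (dvd_refl p) k)) a) ^ (p - 1)).trans
      (sum_add_cast_pow_sub_one _ _)
    refine (congrArg (fun y => -(y * C t)) h2).trans ?_
    ring
  simp_rw [action_mul_apply, ← map_sum, h1, translationAction_C]
  rfl

theorem sum_smul_translationAction_mul_coe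
    (hfZ : ∀ z : Z, f z = algebraMap k A (ZMod.castHom dvd_rfl k (e z).toAdd))
    [Nontrivial A] [Fintype Z] (g : G) :
    ∑ z : Z, (ZMod.castHom dvd_rfl k (e z).toAdd : k) •
        translationAction _ f hf (g * z) (-(X ^ (p - 1) * C t)) =
      -((X + C (f g) + algebraMap k A[X] (ZMod.castHom dvd_rfl k (∑ a : ZMod p, a))) *
        C (ρ g t)) := by
  have h1 : ∑ z : Z, (ZMod.castHom dvd_rfl k (e z).toAdd : k) •
      translationAction _ f hf (z : G) (-(X ^ (p - 1) * C t)) =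
      -((X + algebraMap k A[X] (ZMod.castHom dvd_rfl k (∑ a : ZMod p, a))) * C t) := by
    have : CharP A[X] p := charP_of_injective_algebraMap (algebraMap k A[X]).injective p
    simp only [map_neg, map_mul, map_pow, translationAction_coe_subgroup_C ρ f hf,
      translationAction_coe_subgroup_X e ρ f hf hfZ]
    simp only [smul_neg, ← smul_mul_assoc]
    rw [Finset.sum_neg_distrib, ← Finset.sum_mul]
    congr 2
    simp only [Algebra.smul_def]
    exact ((e.toEquiv.trans Multiplicative.toAdd).sum_comp fun a =>
      ((algebraMap k A[X]).comp (ZMod.castHom (dvd_refl p) k)) a *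
        (X + ((algebraMap k A[X]).comp (ZMod.castHom (dvd_refl p) k)) a) ^ (p - 1)).trans
      (sum_cast_mul_add_cast_pow_sub_one _ _)
  have h2 (z : Z) : (ZMod.castHom dvd_rfl k (e z).toAdd : k) •
      translationAction _ f hf (g * z) (-(X ^ (p - 1) * C t)) =
      translationAction _ f hf g ((ZMod.castHom dvd_rfl k (e z).toAdd : k) •
        translationAction _ f hf (z : G) (-(X ^ (p - 1) * C t))) := by
    rw [map_smul, action_mul_apply]
  rw [Finset.sum_congr rfl fun z _ => h2 z, ← map_sum, h1]
  simp only [map_neg, map_mul, map_add, translationAction_C, translationAction_X,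
    AlgHom.commutes]
  rfl

/-- If `t` has trace one for `G ⧸ Z`, then `-X ^ (p - 1) * t` has trace one for `G`. -/
theorem sum_translationAction_eq_one
    (hfZ : ∀ z : Z, f z = algebraMap k A (ZMod.castHom dvd_rfl k (e z).toAdd))
    [Fintype G] [Fintype (G ⧸ Z)] (ht : ∑ x, ρ x t = 1) :
    ∑ g, translationAction _ f hf g (-(X ^ (p - 1) * C t)) = 1 := by
  classical
  have : Fintype Z := Fintype.ofFinite Z
  rw [sum_eq_sum_quotient_sum_subgroup Z]
  simp_rw [sum_translationAction_mul_coe e ρ t f hf hfZ, QuotientGroup.out_eq', ← map_sum, ht,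
    map_one]

/-- If the orbit of `t` generates `A`, then the orbit of `-X ^ (p - 1) * t` generates `A[X]`. -/
theorem adjoin_orbit_translationAction_eq_top
    (hfZ : ∀ z : Z, f z = algebraMap k A (ZMod.castHom dvd_rfl k (e z).toAdd))
    [Nontrivial A] [Fintype G] [Fintype (G ⧸ Z)]
    (ht : ∑ x, ρ x t = 1) (hgen : Algebra.adjoin k (Set.range fun x => ρ x t) = ⊤) :
    Algebra.adjoin k
      (Set.range fun g => translationAction _ f hf g (-(X ^ (p - 1) * C t))) = ⊤ := by
  classical
  have : Fintype Z := Fintype.ofFinite Z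
  set S := Algebra.adjoin k
    (Set.range fun g => translationAction _ f hf g (-(X ^ (p - 1) * C t)))
  have horb (g : G) : translationAction _ f hf g (-(X ^ (p - 1) * C t)) ∈ S :=
    Algebra.subset_adjoin ⟨g, rfl⟩
  have hCt (x : G ⧸ Z) : C (ρ x t) ∈ S := by
    obtain ⟨g, rfl⟩ := QuotientGroup.mk_surjective x
    rw [← sum_translationAction_mul_coe e ρ t f hf hfZ]
    exact sum_mem fun z _ => horb _
  have hC (a : A) : C a ∈ S := by
    have h1 : (⊤ : Subalgebra k A) ≤ S.comap CAlgHom := by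
      rw [← hgen, Algebra.adjoin_le_iff]
      rintro _ ⟨x, rfl⟩
      exact hCt x
    exact h1 (Algebra.mem_top (x := a))
  have hXt (x : G ⧸ Z) : X * C (ρ x t) ∈ S := by
    obtain ⟨g, rfl⟩ := QuotientGroup.mk_surjective x
    have h1 := sum_smul_translationAction_mul_coe e ρ t f hf hfZ g
    have h2 : (X : A[X]) * C (ρ g t) =
        -∑ z : Z, (ZMod.castHom dvd_rfl k (e z).toAdd : k) •
          translationAction _ f hf (g * z) (-(X ^ (p - 1) * C t)) -
        (C (f g) + algebraMap k A[X] (ZMod.castHom dvd_rfl k (∑ a : ZMod p, a))) *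
          C (ρ g t) := by
      rw [h1]; ring
    rw [h2]
    exact sub_mem (neg_mem (sum_mem fun z _ => S.smul_mem (horb _) _))
      (mul_mem (add_mem (hC _) (S.algebraMap_mem _)) (hC _))
  have hX : (X : A[X]) ∈ S := by
    have h1 : (X : A[X]) = ∑ x, X * C (ρ x t) := by
      rw [← Finset.mul_sum, ← map_sum, ht, map_one, mul_one]
    rw [h1]
    exact sum_mem fun x _ => hXt x
  rw [eq_top_iff]
  rintro P -
  rw [P.as_sum_range_C_mul_X_pow]
  exact sum_mem fun i _ => mul_mem (hC _) (pow_mem hX _)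

/-- The element `X ^ p - X - v` is invariant when `v` bounds the cocycle `f ^ p - f`. -/
theorem X_pow_sub_X_sub_C_mem_actionInvariants [Nontrivial A] {v : A}
    (hv : ∀ g : G, ρ g v = v + (f g ^ p - f g)) :
    X ^ p - X - C v ∈ actionInvariants (translationAction _ f hf) := by
  intro g
  have : CharP A[X] p := charP_of_injective_algebraMap (algebraMap k A[X]).injective p
  have h1 : (ρ.comp (QuotientGroup.mk' Z)) g v = v + (f g ^ p - f g) := hv g
  simp only [map_sub, map_pow, translationAction_X, translationAction_C, h1, add_pow_char, map_add]
  ring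

/-- The cocycle `f ^ p - f` is a coboundary of `G ⧸ Z`. -/
theorem exists_apply_eq_add_pow_sub
    (hf : ∀ g h : G, f (g * h) = f g + ρ.comp (QuotientGroup.mk' Z) g (f h))
    (hfZ : ∀ z : Z, f z = algebraMap k A (ZMod.castHom dvd_rfl k (e z).toAdd))
    [Nontrivial A] [Fintype (G ⧸ Z)] (ht : ∑ x, ρ x t = 1) :
    ∃ v, ∀ g : G, ρ g v = v + (f g ^ p - f g) := by
  have : CharP A p := charP_of_injective_algebraMap (algebraMap k A).injective p
  have hf' (g h : G) : f (g * h) = f g + ρ g (f h) := hf g h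
  -- The Frobenius fixes the values of `f` on `Z`, so `f ^ p - f` factors through `G ⧸ Z`.
  have hF (g : G) : f (g : G ⧸ Z).out ^ p - f (g : G ⧸ Z).out = f g ^ p - f g := by
    obtain ⟨z, hz⟩ := QuotientGroup.mk_out_eq_mul Z g
    rw [hz, hf', hfZ, AlgHom.commutes, add_pow_char, ← map_pow, ← map_pow, ZMod.pow_card]
    ring
  obtain ⟨v, hv⟩ := exists_apply_eq_add_of_cocycle ρ ht
    (fun x => f x.out ^ p - f x.out) (fun x y => by
      obtain ⟨g, rfl⟩ := QuotientGroup.mk_surjective x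
      obtain ⟨h, rfl⟩ := QuotientGroup.mk_surjective y
      rw [← QuotientGroup.mk_mul, hF, hF, hF, hf', add_pow_char, map_sub, map_pow]
      ring)
  exact ⟨v, fun g => by rw [hv, hF]⟩

/-- An invariant polynomial of degree less than `p` is constant: modulo its constant term it
vanishes on the prime field. -/
theorem eq_C_of_mem_actionInvariants_of_natDegree_lt
    (hfZ : ∀ z : Z, f z = algebraMap k A (ZMod.castHom dvd_rfl k (e z).toAdd))
    [IsDomain A] {R : A[X]}
    (hR : R ∈ actionInvariants (translationAction _ f hf)) (hdeg : R.natDegree < p) :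
    ∃ a ∈ actionInvariants ρ, C a = R := by
  have hmap (z : Z) : R.map (ρ.comp (QuotientGroup.mk' Z) (z : G) : A →+* A) = R := by
    have h1 : ((z : G) : G ⧸ Z) = 1 := (QuotientGroup.eq_one_iff _).2 z.2
    ext i
    simp [h1]
  have h1 : R - C (R.eval 0) = 0 := by
    apply eq_zero_of_natDegree_lt_card_of_eval_eq_zero (ι := ZMod p)
      (f := (algebraMap k A).comp (ZMod.castHom (dvd_refl p) k))
      (R - C (R.eval 0)) (RingHom.injective _)
    · intro a
      have h2 := hR (e.symm (Multiplicative.ofAdd a) : Z)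
      rw [translationAction_apply, hmap] at h2
      have h3 := congrArg (eval 0) h2
      rw [hfZ, e.apply_symm_apply] at h3
      simp only [eval_comp, eval_add, eval_X, eval_C, zero_add, toAdd_ofAdd] at h3
      simp only [eval_sub, eval_C, RingHom.comp_apply]
      rw [h3, sub_self]
    · rw [natDegree_sub_C, ZMod.card]
      exact hdeg
  have h2 : C (R.eval 0) = R := (sub_eq_zero.1 h1).symm
  refine ⟨R.eval 0, fun x => ?_, h2⟩
  obtain ⟨g, rfl⟩ := QuotientGroup.mk_surjective x
  have h3 := hR g
  rw [← h2, translationAction_C] at h3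
  exact C_injective h3

/-- The invariants of the translation action form a polynomial ring in one variable
`X ^ p - X - v` over the invariants of `ρ`. -/
theorem nonempty_invariants_translationAction_equiv
    (hfZ : ∀ z : Z, f z = algebraMap k A (ZMod.castHom dvd_rfl k (e z).toAdd))
    [IsDomain A] {v : A}
    (hv : ∀ g : G, ρ g v = v + (f g ^ p - f g)) :
    Nonempty ((actionInvariants ρ)[X] ≃ₐ[k] actionInvariants (translationAction _ f hf)) := by
  have hp := (Fact.out : p.Prime)
  set M : A[X] := X ^ p - X - C v with hM
  have hMσ : M ∈ actionInvariants (translationAction _ f hf) :=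
    X_pow_sub_X_sub_C_mem_actionInvariants (p := p) ρ f hf hv
  have hdeg1 : (X + C v : A[X]).degree < (p : ℕ) := by
    rw [degree_X_add_C]; exact_mod_cast hp.one_lt
  have hM' : M = X ^ p - (X + C v) := by rw [hM]; ring
  have hmonic : M.Monic := hM' ▸ monic_X_pow_sub hdeg1
  have hMdeg : M.natDegree = p := by
    rw [hM']
    exact natDegree_eq_of_degree_eq_some
      ((degree_sub_eq_left_of_degree_lt (by rwa [degree_X_pow])).trans (degree_X_pow p))
  have hM1 : M ≠ 1 := by
    intro h
    rw [h, natDegree_one] at hMdeg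
    exact hp.ne_zero hMdeg.symm
  let Θ : (actionInvariants ρ)[X] →ₐ[k] A[X] :=
    aevalTower (CAlgHom.comp (actionInvariants ρ).val) M
  have hΘ (P : (actionInvariants ρ)[X]) :
      Θ P = (P.map ((actionInvariants ρ).val : _ →+* A)).comp M := by
    rw [comp, eval₂_map]
    rfl
  have hinj : Function.Injective Θ := by
    rw [injective_iff_map_eq_zero]
    intro P hP
    rw [hΘ, comp_eq_zero_iff] at hP
    rcases hP with hP | ⟨-, hP⟩
    · exact (Polynomial.map_eq_zero_iff Subtype.val_injective).1 hP
    · have := congrArg natDegree hP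
      rw [hMdeg, natDegree_C] at this
      exact absurd this hp.ne_zero
  have hle : Θ.range ≤ actionInvariants (translationAction _ f hf) := by
    rintro _ ⟨P, rfl⟩
    induction P using Polynomial.induction_on' with
    | add P Q hP hQ =>
      have := add_mem hP hQ
      rwa [← map_add Θ.toRingHom] at this
    | monomial n a =>
      rw [← C_mul_X_pow_eq_monomial]
      have h1 : Θ (C a * X ^ n) = C (a : A) * M ^ n := by
        rw [map_mul, map_pow]
        congr 1
        · exact aevalTower_C _ _ _
        · congr 1
          exact aevalTower_X _ _
      change Θ (C a * X ^ n) ∈ _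
      rw [h1]
      refine mul_mem (fun g => ?_) (pow_mem hMσ n)
      rw [translationAction_C]
      exact congrArg C (a.2 g)
  -- Divide an invariant polynomial by the invariant monic polynomial `M`: by uniqueness the
  -- quotient and the remainder are invariant, and the remainder is constant.
  have hge (d : ℕ) : ∀ P ∈ actionInvariants (translationAction _ f hf), P.natDegree ≤ d →
      P ∈ Θ.range := by
    induction d using Nat.strong_induction_on with
    | _ d ih =>
      intro P hP hPd
      have hdiv := modByMonic_add_div P M
      have hinv (g : G) : P /ₘ M = translationAction _ f hf g (P /ₘ M) ∧
          P %ₘ M = translationAction _ f hf g (P %ₘ M) := by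
        apply div_modByMonic_unique _ _ hmonic
        constructor
        · have h1 := congrArg (translationAction _ f hf g) hdiv
          rw [map_add, map_mul, hMσ g, hP g] at h1
          exact h1
        · by_cases h0 : P %ₘ M = 0
          · rw [h0, map_zero, degree_zero, bot_lt_iff_ne_bot]
            exact fun h => hmonic.ne_zero (degree_eq_bot.1 h)
          · apply degree_lt_degree
            refine (natDegree_translationAction_le _ f hf g _).trans_lt
              (natDegree_modByMonic_lt P hmonic hM1)
      obtain ⟨a, ha, haR⟩ := eq_C_of_mem_actionInvariants_of_natDegree_lt e ρ f hf hfZ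
        (R := P %ₘ M) (fun g => (hinv g).2.symm)
        ((natDegree_modByMonic_lt P hmonic hM1).trans_eq hMdeg)
      have hC : C a ∈ Θ.range := ⟨C ⟨a, ha⟩, aevalTower_C _ _ _⟩
      have hMr : M ∈ Θ.range := ⟨X, aevalTower_X _ _⟩
      rw [← hdiv, ← haR]
      refine add_mem hC (mul_mem hMr ?_)
      by_cases hlt : P.natDegree < p
      · rw [(divByMonic_eq_zero_iff hmonic).2]
        · exact zero_mem _
        · exact degree_lt_degree (hlt.trans_eq hMdeg.symm)
      · refine ih (d - 1) (by have := hp.pos; omega) _ (fun g => (hinv g).1.symm) ?_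
        rw [natDegree_divByMonic _ hmonic, hMdeg]
        have := hp.pos
        omega
  have hrange : Θ.range = actionInvariants (translationAction _ f hf) :=
    le_antisymm hle fun P hP => hge _ P hP le_rfl
  exact ⟨(AlgEquiv.ofInjective Θ hinj).trans (Subalgebra.equivOfEq _ _ hrange)⟩

end CentralExtension

universe u v

/-! ### Triangular projective models -/

/-- A triangular model of `G` of dimension `n`: a polynomial ring `B` in `n` variables `Y i` with a
triangular action of `G`, generated by the orbit of an element `t` of trace one, whose invariants
form a polynomial ring in `n` variables, and which is projective with respect to equivariant
surjections from algebras with an element of trace one.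

Projectivity is required for all groups `H` acting through a homomorphism `H → G`; this is what
allows induction along central extensions. -/
structure TriangularModel (k : Type u) [Field k] (G : Type v) [Group G] [Fintype G] (n : ℕ) where
  /-- The underlying algebra. -/
  B : Type u
  [commRing : CommRing B]
  [algebra : Algebra k B]
  /-- The action. -/
  ρ : G →* (B →ₐ[k] B)
  /-- The polynomial coordinates on `B`. -/
  coord : MvPolynomial (Fin n) k ≃ₐ[k] B
  triangular : ∀ g i, ρ g (coord (.X i)) - coord (.X i) ∈
    Algebra.adjoin k ((fun j => coord (.X j)) '' {j | i < j})
  /-- The generating element of trace one. -/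
  t : B
  sum_t : ∑ g, ρ g t = 1
  adjoin_orbit : Algebra.adjoin k (Set.range fun g => ρ g t) = ⊤
  invariants : Nonempty (actionInvariants ρ ≃ₐ[k] MvPolynomial (Fin n) k)
  projective : ∀ (H : Type v) [Group H] [Fintype H] (φ : H →* G)
    (D : Type (max u v)) [CommRing D] [Algebra k D] (A : Type u) [CommRing A] [Algebra k A]
    (ρD : H →* (D →ₐ[k] D)) (ρA : H →* (A →ₐ[k] A)) (s : D), ∑ h, ρD h s = 1 →
    ∀ (π : D →ₐ[k] A), Function.Surjective π → (∀ h d, π (ρD h d) = ρA h (π d)) →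
    ∀ (τ : B →ₐ[k] A), (∀ h b, τ (ρ (φ h) b) = ρA h (τ b)) →
    ∃ σ : B →ₐ[k] D, (∀ b, π (σ b) = τ b) ∧ ∀ h b, σ (ρ (φ h) b) = ρD h (σ b)

attribute [instance] TriangularModel.commRing TriangularModel.algebra

/-- The base field is a model of the trivial group. -/
noncomputable def TriangularModel.ofSubsingleton (k : Type u) [Field k] (G : Type v) [Group G]
    [Fintype G] [Subsingleton G] : TriangularModel k G 0 where
  B := k
  ρ := 1
  coord := MvPolynomial.isEmptyAlgEquiv k (Fin 0)
  triangular _ i := i.elim0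
  t := 1
  sum_t := by rw [Fintype.sum_subsingleton _ (1 : G)]; rfl
  adjoin_orbit := Subsingleton.elim _ _
  invariants := by
    have h : actionInvariants (1 : G →* (k →ₐ[k] k)) = ⊤ := Subsingleton.elim _ _
    exact ⟨((Subalgebra.equivOfEq _ _ h).trans Subalgebra.topEquiv).trans
      (MvPolynomial.isEmptyAlgEquiv k (Fin 0)).symm⟩
  projective H _ _ φ D _ _ A _ _ ρD ρA s hs π hπ hπρ τ hτ :=
    ⟨Algebra.ofId k D, fun b => by
      rw [Algebra.ofId_apply, AlgHom.commutes]; exact (τ.commutes b).symm,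
      fun h b => by simp [Algebra.ofId_apply]⟩

/-- An equivariant lift on `B` extends to `B[X]` with a translation action: the image of `X` is
found by bounding a cocycle in `D` and then correcting the result by an invariant. -/
theorem exists_equivariant_lift_of_translationAction {k H B D A : Type*} [Field k] [Group H]
    [Fintype H] [CommRing B] [Algebra k B] [CommRing D] [Algebra k D] [CommRing A] [Algebra k A]
    (ρ : H →* (B →ₐ[k] B)) (f : H → B) (hf : ∀ g h, f (g * h) = f g + ρ g (f h))
    (ρD : H →* (D →ₐ[k] D)) (ρA : H →* (A →ₐ[k] A)) {s : D} (hs : ∑ h, ρD h s = 1)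
    (π : D →ₐ[k] A) (hπ : Function.Surjective π) (hπρ : ∀ h d, π (ρD h d) = ρA h (π d))
    (τ : B[X] →ₐ[k] A) (hτ : ∀ h b, τ (translationAction ρ f hf h b) = ρA h (τ b))
    (σ₀ : B →ₐ[k] D) (hσ₀ : ∀ b, π (σ₀ b) = τ (C b)) (hσ₀ρ : ∀ h b, σ₀ (ρ h b) = ρD h (σ₀ b)) :
    ∃ σ : B[X] →ₐ[k] D, (∀ b, π (σ b) = τ b) ∧
      ∀ h b, σ (translationAction ρ f hf h b) = ρD h (σ b) := by
  obtain ⟨d, hd⟩ := exists_apply_eq_add_of_cocycle ρD hs (fun h => σ₀ (f h)) fun g h => by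
    rw [hf, map_add, hσ₀ρ]
  have hinv : τ X - π d ∈ actionInvariants ρA := fun h => by
    rw [map_sub, ← hτ, ← hπρ, hd, translationAction_X, map_add, map_add, hσ₀]
    ring
  obtain ⟨d', hd', hd'τ⟩ := exists_mem_actionInvariants_of_surjective ρD ρA hs π hπ hπρ hinv
  have hC (b : B) : aevalTower σ₀ (d + d') (C b) = σ₀ b := aevalTower_C _ _ _
  have hX : aevalTower σ₀ (d + d') X = d + d' := aevalTower_X _ _
  refine ⟨aevalTower σ₀ (d + d'), fun b => ?_, fun h b => ?_⟩
  · refine DFunLike.congr_fun (f := π.comp (aevalTower σ₀ (d + d'))) (g := τ) ?_ b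
    apply Polynomial.algHom_ext'
    · ext b
      simp [hσ₀]
    · simp [hd'τ]
  · refine DFunLike.congr_fun
      (f := (aevalTower σ₀ (d + d')).comp (translationAction ρ f hf h))
      (g := (ρD h).comp (aevalTower σ₀ (d + d'))) ?_ b
    apply Polynomial.algHom_ext'
    · ext b
      simp [translationAction_C, hσ₀ρ]
    · simp only [AlgHom.comp_apply, translationAction_X, map_add, hC, hX, hd, hd' h]
      ring

/-- A model of `G ⧸ Z`, for `Z` central of order `p`, extends by one variable to a model of `G`. -/
theorem TriangularModel.nonempty_of_quotient {p : ℕ} [Fact p.Prime] {k : Type u} [Field k]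
    [CharP k p] {G : Type v} [Group G] [Fintype G] {Z : Subgroup G} [Z.Normal] [Fintype (G ⧸ Z)]
    (hZ : Z ≤ Subgroup.center G) (e : Z ≃* Multiplicative (ZMod p)) {n : ℕ}
    (m : TriangularModel k (G ⧸ Z) n) : Nonempty (TriangularModel k G (n + 1)) := by
  have : IsDomain m.B := m.coord.symm.toMulEquiv.isDomain _
  obtain ⟨f, hf, hfZ⟩ := exists_cocycle_extending Z hZ m.ρ m.sum_t
    ((AddMonoidHom.toMultiplicative (ZMod.castHom (dvd_refl p) k).toAddMonoidHom).comp
      e.toMonoidHom)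
  replace hf (g h : G) : f (g * h) = f g + m.ρ.comp (QuotientGroup.mk' Z) g (f h) := hf g h
  replace hfZ (z : Z) : f z = algebraMap k m.B (ZMod.castHom dvd_rfl k (e z).toAdd) := hfZ z
  obtain ⟨v, hv⟩ := exists_apply_eq_add_pow_sub e m.ρ m.t f hf hfZ m.sum_t
  let coord : MvPolynomial (Fin (n + 1)) k ≃ₐ[k] m.B[X] :=
    (MvPolynomial.finSuccEquiv k n).trans (Polynomial.mapAlgEquiv m.coord)
  have coord_zero : coord (.X 0) = X := by
    simp [coord, MvPolynomial.finSuccEquiv_X_zero]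
  have coord_succ (j : Fin n) : coord (.X j.succ) = C (m.coord (.X j)) := by
    simp [coord, MvPolynomial.finSuccEquiv_X_succ]
  have hmap (s : Set (Fin n)) (s' : Set (Fin (n + 1))) (hs : ∀ j ∈ s, j.succ ∈ s') (b : m.B)
      (hb : b ∈ Algebra.adjoin k ((fun j => m.coord (.X j)) '' s)) :
      C b ∈ Algebra.adjoin k ((fun j => coord (.X j)) '' s') := by
    have h1 : Algebra.adjoin k ((fun j => m.coord (.X j)) '' s) ≤
        (Algebra.adjoin k ((fun j => coord (.X j)) '' s')).comap CAlgHom := by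
      rw [Algebra.adjoin_le_iff]
      rintro _ ⟨j, hj, rfl⟩
      exact Algebra.subset_adjoin ⟨j.succ, hs j hj, coord_succ j⟩
    exact h1 hb
  have htop : Algebra.adjoin k ((fun j => m.coord (.X j)) '' Set.univ) = ⊤ := by
    rw [Set.image_univ]
    have h1 : (Set.range fun j => m.coord (.X j)) =
        m.coord.toAlgHom '' Set.range (MvPolynomial.X : Fin n → MvPolynomial (Fin n) k) := by
      rw [← Set.range_comp]; rfl
    rw [h1, Algebra.adjoin_image, MvPolynomial.adjoin_range_X, Algebra.map_top]
    exact (AlgHom.range_eq_top _).2 m.coord.surjective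
  obtain ⟨E⟩ := nonempty_invariants_translationAction_equiv e m.ρ f hf hfZ hv
  obtain ⟨E'⟩ := m.invariants
  refine ⟨{
    B := m.B[X]
    ρ := translationAction _ f hf
    coord := coord
    triangular := fun g i => ?_
    t := -(X ^ (p - 1) * C m.t)
    sum_t := sum_translationAction_eq_one e m.ρ m.t f hf hfZ m.sum_t
    adjoin_orbit := adjoin_orbit_translationAction_eq_top e m.ρ m.t f hf hfZ m.sum_t
      m.adjoin_orbit
    invariants := ⟨(E.symm.trans (Polynomial.mapAlgEquiv E')).trans
      (MvPolynomial.finSuccEquiv k n).symm⟩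
    projective := ?_ }⟩
  · refine Fin.cases ?_ (fun i => ?_) i
    · rw [coord_zero, translationAction_X, add_sub_cancel_left]
      exact hmap Set.univ _ (fun j _ => Fin.succ_pos j) _ (htop ▸ Algebra.mem_top)
    · rw [coord_succ, translationAction_C, ← C_sub]
      exact hmap {j | i < j} _ (fun j hj => Fin.succ_lt_succ_iff.2 hj) _ (m.triangular g i)
  · intro H _ _ φ D _ _ A _ _ ρD ρA s hs π hπ hπρ τ hτ
    obtain ⟨σ₀, h1, h2⟩ := m.projective H ((QuotientGroup.mk' Z).comp φ) D A ρD ρA s hs π hπ hπρ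
      (τ.comp CAlgHom) fun h b => by
        have := hτ h (C b)
        rw [translationAction_C] at this
        exact this
    exact exists_equivariant_lift_of_translationAction
      ((m.ρ.comp (QuotientGroup.mk' Z)).comp φ) (fun h => f (φ h))
      (fun g h => by rw [map_mul, hf]; rfl) ρD ρA hs π hπ hπρ τ hτ σ₀ h1 h2

/-- A nontrivial finite `p`-group has a central subgroup of order `p`. -/
theorem exists_subgroup_le_center_mulEquiv {p : ℕ} [Fact p.Prime] {G : Type*} [Group G] [Finite G]
    {n : ℕ} (hG : Nat.card G = p ^ (n + 1)) :
    ∃ Z : Subgroup G, Z ≤ Subgroup.center G ∧ Nonempty (Z ≃* Multiplicative (ZMod p)) := by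
  have hp := (Fact.out : p.Prime)
  have : Nontrivial G := by
    rw [← Finite.one_lt_card_iff_nontrivial, hG]
    exact Nat.one_lt_pow (Nat.succ_ne_zero n) hp.one_lt
  have hpG : IsPGroup p G := IsPGroup.of_card hG
  have := hpG.center_nontrivial
  obtain ⟨m, hm, hcard⟩ :=
    (hpG.to_subgroup (Subgroup.center G)).nontrivial_iff_card.1 this
  obtain ⟨z, hz⟩ := exists_prime_orderOf_dvd_card' (G := Subgroup.center G) p
    (hcard ▸ dvd_pow_self p hm.ne')
  refine ⟨Subgroup.zpowers (z : G), ?_, ⟨mulEquivOfPrimeCardEq (p := p) ?_ ?_⟩⟩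
  · rw [Subgroup.zpowers_le]
    exact z.2
  · rw [Nat.card_zpowers, Subgroup.orderOf_coe, hz]
  · rw [Nat.card_congr Multiplicative.toAdd, Nat.card_zmod]

theorem TriangularModel.nonempty_of_card_eq_pow {p : ℕ} [Fact p.Prime] (k : Type u) [Field k]
    [CharP k p] (n : ℕ) : ∀ (G : Type v) [Group G] [Fintype G], Nat.card G = p ^ n →
      Nonempty (TriangularModel k G n) := by
  induction n with
  | zero =>
    intro G _ _ hG
    have : Subsingleton G := (Nat.card_eq_one_iff_unique.1 (by simpa using hG)).1
    exact ⟨TriangularModel.ofSubsingleton k G⟩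
  | succ n ih =>
    intro G _ _ hG
    obtain ⟨Z, hZ, ⟨e⟩⟩ := exists_subgroup_le_center_mulEquiv hG
    have : Z.Normal := ⟨fun z hz g => by
      rwa [Subgroup.mem_center_iff.1 (hZ hz) g, mul_inv_cancel_right]⟩
    have : Fintype (G ⧸ Z) := Fintype.ofFinite _
    have hcard : Nat.card (G ⧸ Z) = p ^ n := by
      have h1 := Subgroup.card_eq_card_quotient_mul_card_subgroup Z
      rw [hG, Nat.card_congr e.toEquiv, Nat.card_congr Multiplicative.toAdd, Nat.card_zmod,
        pow_succ] at h1
      exact (Nat.eq_of_mul_eq_mul_right (Fact.out : p.Prime).pos h1).symm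
    obtain ⟨m⟩ := ih (G ⧸ Z) hcard
    exact TriangularModel.nonempty_of_quotient hZ e m

/-! ### The universal property of the dehomogenized symmetric algebra -/

section DehomSym

variable {k G : Type*} [Field k] [Group G] [Fintype G]

/-- The action of `Gᵐᵒᵖ` on `D_k` as a homomorphism to the algebra endomorphisms. -/
noncomputable def dehomAction (k G : Type*) [Field k] [Group G] [Fintype G] :
    Gᵐᵒᵖ →* (DehomSym k G →ₐ[k] DehomSym k G) where
  toFun g := DehomSym.act k g.unop
  map_one' := by
    ext a
    exact one_smul Gᵐᵒᵖ a
  map_mul' g h := by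
    ext a
    exact mul_smul g h a

theorem dehomAction_mk_symX (g : Gᵐᵒᵖ) (x : G) :
    dehomAction k G g (DehomSym.mk k G (symX k x)) = DehomSym.mk k G (symX k (x * g.unop)) := by
  rw [← symRightMul_symX]
  rfl

theorem sum_mk_symX : ∑ x : G, DehomSym.mk k G (symX k x) = 1 := by
  have h : DehomSym.mk k G (dehomRelation k G) = 0 :=
    Ideal.Quotient.eq_zero_iff_mem.2 (Ideal.mem_span_singleton_self _)
  rw [dehomRelation, map_add, map_neg, map_one, map_sum] at h
  linear_combination h

theorem sum_dehomAction_mk_symX_one [Fintype Gᵐᵒᵖ] :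
    ∑ g, dehomAction k G g (DehomSym.mk k G (symX k 1)) = 1 := by
  simp_rw [dehomAction_mk_symX, one_mul]
  rw [← sum_mk_symX (k := k) (G := G)]
  exact Fintype.sum_equiv MulOpposite.opEquiv.symm _ _ fun _ => rfl

theorem DehomSym.algHom_ext {A : Type*} [CommRing A] [Algebra k A] {φ ψ : DehomSym k G →ₐ[k] A}
    (h : ∀ x, φ (DehomSym.mk k G (symX k x)) = ψ (DehomSym.mk k G (symX k x))) : φ = ψ := by
  have h1 : φ.comp (DehomSym.mk k G) = ψ.comp (DehomSym.mk k G) := by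
    apply SymmetricAlgebra.algHom_ext
    apply MonoidAlgebra.lhom_ext'
    intro x
    ext
    exact h x
  ext a
  obtain ⟨s, rfl⟩ := DehomSym.mk_surjective k G a
  exact DFunLike.congr_fun h1 s

/-- An element `t` of trace one determines an equivariant homomorphism from `D_k` that sends `X_g`
to `t · g`. -/
theorem DehomSym.exists_algHom [Fintype Gᵐᵒᵖ] {A : Type*} [CommRing A] [Algebra k A]
    (ρ : Gᵐᵒᵖ →* (A →ₐ[k] A)) {t : A} (ht : ∑ g, ρ g t = 1) :
    ∃ τ : DehomSym k G →ₐ[k] A, (∀ x, τ (DehomSym.mk k G (symX k x)) = ρ (.op x) t) ∧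
      ∀ g a, τ (dehomAction k G g a) = ρ g (τ a) := by
  let τ₀ : SymmetricAlgebra k (MonoidAlgebra k G) →ₐ[k] A :=
    SymmetricAlgebra.lift (Finsupp.linearCombination k (fun x : G => ρ (.op x) t) ∘ₗ
      (MonoidAlgebra.coeffLinearEquiv k).toLinearMap)
  have hτ₀ (x : G) : τ₀ (symX k x) = ρ (.op x) t := by
    simp [τ₀, symX]
  have hrel : τ₀ (dehomRelation k G) = 0 := by
    rw [dehomRelation, map_add, map_neg, map_one, map_sum]
    simp_rw [hτ₀]
    rw [neg_add_eq_zero, ← ht]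
    exact Fintype.sum_equiv MulOpposite.opEquiv.symm _ _ fun _ => rfl
  have hker : Ideal.span {dehomRelation k G} ≤ RingHom.ker τ₀ := by
    rwa [Ideal.span_singleton_le_iff_mem]
  let τ : DehomSym k G →ₐ[k] A :=
    Ideal.Quotient.liftₐ (Ideal.span {dehomRelation k G}) τ₀ fun a ha => hker ha
  have hτ (x : G) : τ (DehomSym.mk k G (symX k x)) = ρ (.op x) t := hτ₀ x
  refine ⟨τ, hτ, fun g a => ?_⟩
  refine DFunLike.congr_fun (f := τ.comp (dehomAction k G g)) (g := (ρ g).comp τ) ?_ a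
  apply DehomSym.algHom_ext
  intro x
  rw [AlgHom.comp_apply, AlgHom.comp_apply, dehomAction_mk_symX, hτ, hτ, ← action_mul_apply]
  rfl

end DehomSym

/-! ### The retract of `D_k` -/

theorem theorem1p1 (p n : ℕ) [Fact p.Prime] (k G : Type*) [Field k] [CharP k p]
    [Group G] [Fintype G] (hG : Nat.card G = p ^ n) :
    ∃ (U : Subalgebra k (DehomSym k G)) (I : Ideal (DehomSym k G)) (Y : Fin n → DehomSym k G),
      -- `U` is a trace-surjective `G`-subalgebra and `D_k = U ⊕ I` with `I` a `G`-stable ideal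
      IsTraceSurjectiveSubalgebra G U ∧
      IsGStable G (I : Set (DehomSym k G)) ∧
      IsCompl (Subalgebra.toSubmodule U) (I.restrictScalars k) ∧
      -- `U = k[Y_0, …, Y_{n-1}]` is a polynomial ring
      AlgebraicIndependent k Y ∧
      Algebra.adjoin k (Set.range Y) = U ∧
      -- the action is triangular
      (∀ (g : G) (i : Fin n), ∃ f : MvPolynomial {j : Fin n // i < j} k,
        MulOpposite.op g • Y i = Y i + MvPolynomial.aeval (fun j => Y j.1) f) ∧
      -- `U^G` is a polynomial ring in `n` variables
      Nonempty (invariantSubalgebra G U ≃ₐ[k] MvPolynomial (Fin n) k) := by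
  let eG : G ≃ Gᵐᵒᵖ := MulOpposite.opEquiv
  have : Fintype Gᵐᵒᵖ := Fintype.ofEquiv G eG
  obtain ⟨m⟩ := TriangularModel.nonempty_of_card_eq_pow (p := p) k n Gᵐᵒᵖ
    (by rw [← Nat.card_congr eG, hG])
  obtain ⟨τ, hτ, hτρ⟩ := DehomSym.exists_algHom m.ρ m.sum_t
  have hτsurj : Function.Surjective τ := by
    rw [← AlgHom.range_eq_top, eq_top_iff, ← m.adjoin_orbit, Algebra.adjoin_le_iff]
    rintro _ ⟨g, rfl⟩
    exact ⟨_, hτ g.unop⟩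
  obtain ⟨σ, hτσ, hσρ⟩ := m.projective Gᵐᵒᵖ (MonoidHom.id _) (DehomSym k G) m.B
    (dehomAction k G) m.ρ _ sum_dehomAction_mk_symX_one τ hτsurj hτρ (AlgHom.id k m.B)
    fun _ _ => rfl
  replace hτσ (b : m.B) : τ (σ b) = b := hτσ b
  replace hσρ (g : Gᵐᵒᵖ) (b : m.B) : g • σ b = σ (m.ρ g b) := (hσρ g b).symm
  have hσinj : Function.Injective σ := Function.LeftInverse.injective hτσ
  have htr (b : m.B) : transfer G (σ b) = σ (∑ g, m.ρ g b) := by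
    rw [transfer, map_sum, ← eG.sum_comp]
    exact Finset.sum_congr rfl fun g _ => hσρ _ _
  have hinv : (actionInvariants m.ρ).map σ = invariantSubalgebra G σ.range := by
    ext a
    constructor
    · rintro ⟨b, hb, rfl⟩
      exact ⟨⟨b, rfl⟩, fun g => (hσρ g b).trans (congrArg σ (hb g))⟩
    · rintro ⟨⟨b, rfl⟩, hb⟩
      exact ⟨b, fun g => hσinj ((hσρ g b).symm.trans (hb g)), rfl⟩
  have haeval : MvPolynomial.aeval (fun i => σ (m.coord (.X i))) =
      σ.comp m.coord.toAlgHom := by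
    ext i
    simp
  refine ⟨σ.range, RingHom.ker τ, fun i => σ (m.coord (.X i)), ⟨?_, ?_⟩, ?_, ?_, ?_, ?_, ?_, ?_⟩
  · rintro g _ ⟨b, rfl⟩
    exact ⟨_, (hσρ _ b).symm⟩
  · rw [← hinv]
    ext a
    constructor
    · rintro ⟨_, ⟨b, rfl⟩, rfl⟩
      exact ⟨_, sum_apply_mem_actionInvariants m.ρ b, (htr b).symm⟩
    · rintro ⟨b, hb, rfl⟩
      refine ⟨σ (b * m.t), ⟨_, rfl⟩, ?_⟩
      rw [htr, sum_apply_mul_eq_of_mem_actionInvariants m.ρ m.sum_t hb]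
      rfl
  · intro g a ha
    have h := hτρ (.op g) a
    rw [(RingHom.mem_ker).1 ha, map_zero] at h
    exact h
  · rw [isCompl_iff, Submodule.disjoint_def, codisjoint_iff, eq_top_iff]
    constructor
    · rintro _ ⟨b, rfl⟩ hb
      have h : τ (σ b) = 0 := hb
      rw [hτσ] at h
      subst h
      exact map_zero σ
    · rintro a -
      refine Submodule.mem_sup.2 ⟨σ (τ a), ⟨_, rfl⟩, a - σ (τ a), ?_, add_sub_cancel _ _⟩
      change τ (a - σ (τ a)) = 0
      rw [map_sub, hτσ, sub_self]
  · rw [AlgebraicIndependent, haeval]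
    exact hσinj.comp m.coord.injective
  · rw [Algebra.adjoin_range_eq_range_aeval, haeval, AlgHom.range_comp,
      (AlgHom.range_eq_top m.coord.toAlgHom).2 m.coord.surjective, Algebra.map_top]
  · intro g i
    have h := m.triangular (.op g) i
    rw [Set.image_eq_range, Algebra.adjoin_range_eq_range_aeval] at h
    obtain ⟨f, hf⟩ := h
    refine ⟨f, ?_⟩
    change MvPolynomial.aeval (fun j : {j : Fin n // i < j} => m.coord (.X j.1)) f = _ at hf
    rw [hσρ, ← MvPolynomial.comp_aeval_apply (f := fun j : {j : Fin n // i < j} =>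
      m.coord (.X j.1)) σ, hf, ← map_add, add_sub_cancel]
  · obtain ⟨E⟩ := m.invariants
    exact ⟨((Subalgebra.equivMapOfInjective _ σ hσinj).trans
      (Subalgebra.equivOfEq _ _ hinv)).symm.trans E⟩
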